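/- Let $\sigma = (\lambda_1, \lambda_2, \lambda_3, \lambda_4, \lambda_5)$ be a list of real numbers with $\lambda_1 \ge \lambda_2 \ge \lambda_3 \ge \lambda_4 \ge \lambda_5 \ge -\lambda_1$, and suppose that $\sigma$ is the spectrum (the list of eigenvalues, counted with multiplicity) of a $5 \times 5$ real symmetric entrywise nonnegative matrix of trace zero. For $s > 0$ and $i \in \{2,3,4,5\}$, let $\sigma_i^{-s}$ denote the list obtained from $\sigma$ by replacing $\lambda_1$ by $\lambda_1 + s$ and $\lambda_i$ by $\lambda_i - s$. Then, for every real number $s > 0$ and every $i \in \{2,3,4,5\}$, the list $\sigma_i^{-s}$ (in which the order of the entries is irrelevant) is the spectrum of a $5 \times 5$ real symmetric entrywise nonnegative matrix of trace zero. -/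

import Mathlib

/-- The list `σ` is the spectrum of the real matrix `A`: the real roots of the characteristic
polynomial of `A`, counted with multiplicity, are exactly `σ 0, …, σ (n - 1)` in some order.
(As `σ` has `n` entries, this says that all eigenvalues of `A` are real and listed by `σ`
with their algebraic multiplicities.) -/
def IsSpectrumOf {n : ℕ} (σ : Fin n → ℝ) (A : Matrix (Fin n) (Fin n) ℝ) : Prop :=
  A.charpoly.roots = Finset.univ.val.map σ

/-- The list `σ` is the spectrum of a trace zero symmetric (entrywise) nonnegative matrix of
size `n × n`. -/
def TraceZeroSymmNonnegRealizable {n : ℕ} (σ : Fin n → ℝ) : Prop :=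
  ∃ A : Matrix (Fin n) (Fin n) ℝ,
    A.IsSymm ∧ (∀ i j, 0 ≤ A i j) ∧ A.trace = 0 ∧ IsSpectrumOf σ A

/-- The list `σ` with its first entry replaced by `σ 0 + s` and its entry at `i` replaced by
`σ i - s`; it is meant for `i ≠ 0`. -/
def guoMinus {n : ℕ} [NeZero n] (σ : Fin n → ℝ) (i : Fin n) (s : ℝ) : Fin n → ℝ :=
  Function.update (Function.update σ 0 (σ 0 + s)) i (σ i - s)

/-! Four conditions on a decreasing list suffice for realizability at size five: zero sum,
nonnegative sum of cubes, `λ₁ + λ₅ ≥ 0` and `λ₂ + λ₅ ≤ 0`. The perturbation keeps them. It fixes the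
sum, raises the sum of cubes by `3s(λ₁ + λᵢ)(λ₁ - λᵢ + s) ≥ 0`, and raises no entry but the first.

Of the four, `λ₁ + λ₅ ≥ 0` is assumed, and the sum and cube conditions come from the traces of `A`
and `A ^ 3`. The inequality `λ₂ + λ₅ ≤ 0` (`TraceZeroSymmNonnegRealizable.le_neg`) is special to
size five: when `λ₂ > 0`, one of two orthogonal eigenvectors, up to sign, has one or two positive
entries. This forces an entry of `A` of size at least `λ₂`, while no entry exceeds `-λ₅`.

Sufficiency rests on two explicit matrices, chosen by the sign of `λ₃`. -/

/-- Two families of reals with the same multiset of values differ by a permutation. -/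
theorem exists_perm_comp_eq_of_map_univ_eq {n : ℕ} {f g : Fin n → ℝ}
    (h : Finset.univ.val.map f = Finset.univ.val.map g) : ∃ e : Equiv.Perm (Fin n), f = g ∘ e := by
  have hp : (List.ofFn (f ∘ Tuple.sort f)).Perm (List.ofFn (g ∘ Tuple.sort g)) := by
    refine (Equiv.Perm.ofFn_comp_perm _ _).trans (.trans ?_ (Equiv.Perm.ofFn_comp_perm _ _).symm)
    rwa [Fin.univ_val_map, Fin.univ_val_map, Multiset.coe_eq_coe] at h
  have he := List.ofFn_injective <| hp.eq_of_sortedLE (Tuple.monotone_sort f).sortedLE_ofFn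
    (Tuple.monotone_sort g).sortedLE_ofFn
  refine ⟨(Tuple.sort f).symm.trans (Tuple.sort g), funext fun i => ?_⟩
  simpa using congrFun he ((Tuple.sort f).symm i)

open Matrix in
/-- A real symmetric matrix with spectrum `σ` is diagonalized by an orthogonal matrix whose columns
are ordered as in `σ`. -/
theorem IsSpectrumOf.exists_orthogonal {n : ℕ} {σ : Fin n → ℝ} {A : Matrix (Fin n) (Fin n) ℝ}
    (h : IsSpectrumOf σ A) (hA : A.IsSymm) :
    ∃ U : Matrix (Fin n) (Fin n) ℝ, Uᵀ * U = 1 ∧ U * Uᵀ = 1 ∧ A = U * diagonal σ * Uᵀ := by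
  have hH : A.IsHermitian := by
    rw [IsHermitian, conjTranspose_eq_transpose_of_trivial]; exact hA
  have hroots := hH.roots_charpoly_eq_eigenvalues
  rw [h] at hroots
  obtain ⟨e, he⟩ := exists_perm_comp_eq_of_map_univ_eq hroots
  have hU1 := Unitary.coe_star_mul_self hH.eigenvectorUnitary
  have hsp := hH.spectral_theorem
  rw [Unitary.conjStarAlgAut_apply] at hsp
  set U : Matrix (Fin n) (Fin n) ℝ := (hH.eigenvectorUnitary : Matrix (Fin n) (Fin n) ℝ)
  have hU2 : U * star U = 1 := Unitary.coe_mul_star_self hH.eigenvectorUnitary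
  rw [star_eq_conjTranspose, conjTranspose_eq_transpose_of_trivial] at hU1 hU2 hsp
  refine ⟨U.submatrix id e, ?_, ?_, ?_⟩
  · rw [transpose_submatrix, ← submatrix_mul _ _ _ _ _ Function.bijective_id, hU1,
      submatrix_one_equiv]
  · rw [transpose_submatrix, submatrix_mul_equiv, hU2, submatrix_id_id]
  · have hd : diagonal σ = (diagonal (RCLike.ofReal ∘ hH.eigenvalues)).submatrix e e := by
      rw [submatrix_diagonal_equiv, he]
    rw [transpose_submatrix, hd, submatrix_mul_equiv, submatrix_mul_equiv, ← hsp, submatrix_id_id]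

theorem IsSpectrumOf.sum_eq_trace {n : ℕ} {σ : Fin n → ℝ} {A : Matrix (Fin n) (Fin n) ℝ}
    (h : IsSpectrumOf σ A) (hA : A.IsSymm) : ∑ i, σ i = A.trace := by
  obtain ⟨U, hU, -, rfl⟩ := h.exists_orthogonal hA
  rw [Matrix.mul_assoc, Matrix.trace_mul_comm, Matrix.mul_assoc, hU, Matrix.mul_one,
    Matrix.trace_diagonal]

theorem IsSpectrumOf.sum_cube_eq_trace {n : ℕ} {σ : Fin n → ℝ} {A : Matrix (Fin n) (Fin n) ℝ}
    (h : IsSpectrumOf σ A) (hA : A.IsSymm) : ∑ i, σ i ^ 3 = (A ^ 3).trace := by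
  obtain ⟨U, hU, -, rfl⟩ := h.exists_orthogonal hA
  have key : (U * Matrix.diagonal σ * U.transpose) ^ 3
      = U * (Matrix.diagonal (fun i => σ i ^ 3) * U.transpose) := by
    have : Matrix.diagonal (fun i => σ i ^ 3) = Matrix.diagonal σ ^ 3 := by
      rw [Matrix.diagonal_pow]; rfl
    rw [this]
    calc _ = U * Matrix.diagonal σ * (U.transpose * U) * Matrix.diagonal σ * (U.transpose * U)
              * Matrix.diagonal σ * U.transpose := by noncomm_ring
      _ = _ := by rw [hU]; noncomm_ring
  rw [key, Matrix.trace_mul_comm, Matrix.mul_assoc, hU, Matrix.mul_one, Matrix.trace_diagonal]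

/-! ### Necessity: the second largest and least eigenvalues -/

/-- A symmetric matrix with zero diagonal whose least eigenvalue is at least `m` has no entry
larger than `-m`. -/
theorem IsSpectrumOf.apply_le_neg {n : ℕ} {σ : Fin n → ℝ} {A : Matrix (Fin n) (Fin n) ℝ}
    (h : IsSpectrumOf σ A) (hA : A.IsSymm) (hdiag : ∀ i, A i i = 0) {m : ℝ} (hm : ∀ k, m ≤ σ k)
    {i j : Fin n} (hij : i ≠ j) : A i j ≤ -m := by
  obtain ⟨U, -, hU, hAU⟩ := h.exists_orthogonal hA
  have e1 : ∀ a b, A a b = ∑ k, U a k * σ k * U b k := fun a b => by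
    conv_lhs => rw [hAU, Matrix.mul_apply]
    simp [Matrix.mul_diagonal]
  have e2 : ∀ a b, ∑ k, U a k * U b k = (1 : Matrix (Fin n) (Fin n) ℝ) a b := fun a b => by
    rw [← hU]; simp [Matrix.mul_apply]
  -- The quadratic form of `A - m • 1` at `e_i - e_j`, written in the eigenbasis.
  have e3 : 0 ≤ ∑ k, (σ k - m) * (U i k - U j k) ^ 2 :=
    Finset.sum_nonneg fun k _ => mul_nonneg (sub_nonneg.2 (hm k)) (sq_nonneg _)
  have e4 : ∑ k, (σ k - m) * (U i k - U j k) ^ 2 = A i i - 2 * A i j + A j j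
      - m * (∑ k, U i k * U i k - 2 * ∑ k, U i k * U j k + ∑ k, U j k * U j k) := by
    simp only [e1, Finset.mul_sum, ← Finset.sum_add_distrib, ← Finset.sum_sub_distrib]
    exact Finset.sum_congr rfl fun k _ => by ring
  rw [e4, e2, e2, e2, hdiag, hdiag, Matrix.one_apply_eq, Matrix.one_apply_eq,
    Matrix.one_apply_ne hij] at e3
  linarith

/-- An eigenvector of a nonnegative matrix with zero diagonal, for a positive eigenvalue `μ`, that
has one or two positive entries forces an off-diagonal entry of size at least `μ`. -/
theorem exists_le_apply_of_card_pos_le_two {n : ℕ} {A : Matrix (Fin n) (Fin n) ℝ}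
    (hA : A.IsSymm) (hnn : ∀ i j, 0 ≤ A i j) (hdiag : ∀ i, A i i = 0) {μ : ℝ} (hμ : 0 < μ)
    {x : Fin n → ℝ} (hx : ∀ i, ∑ j, A i j * x j = μ * x i) (hpos : ∃ i, 0 < x i)
    (hcard : (Finset.univ.filter fun i => 0 < x i).card ≤ 2) : ∃ i j, i ≠ j ∧ μ ≤ A i j := by
  set S := Finset.univ.filter fun i => 0 < x i with hS
  have hle : ∀ i, μ * x i ≤ ∑ j ∈ S, A i j * x j := fun i => by
    rw [← hx i, ← Finset.sum_filter_add_sum_filter_not _ (fun i => 0 < x i)]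
    have : ∑ j ∈ Finset.univ.filter (fun i => ¬ 0 < x i), A i j * x j ≤ 0 :=
      Finset.sum_nonpos fun j hj =>
        mul_nonpos_of_nonneg_of_nonpos (hnn i j) (not_lt.1 (Finset.mem_filter.1 hj).2)
    linarith
  obtain ⟨i, hi⟩ := hpos
  have hiS : i ∈ S := by simp [hS, hi]
  have h1 : 1 ≤ S.card := Finset.card_pos.2 ⟨i, hiS⟩
  obtain h | h : S.card = 1 ∨ S.card = 2 := by omega
  · obtain ⟨a, ha⟩ := Finset.card_eq_one.1 h
    obtain rfl : i = a := by simpa [ha] using hiS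
    have := hle i
    rw [ha, Finset.sum_singleton, hdiag] at this
    nlinarith [mul_pos hμ hi]
  · obtain ⟨a, b, hab, hSab⟩ := Finset.card_eq_two.1 h
    have hxa : 0 < x a := by
      have : a ∈ S := by simp [hSab]
      simpa [hS] using this
    have hxb : 0 < x b := by
      have : b ∈ S := by simp [hSab]
      simpa [hS] using this
    have ha := hle a
    have hb := hle b
    rw [hSab, Finset.sum_pair hab, hdiag] at ha hb
    rw [hA.apply a b] at hb
    refine ⟨a, b, hab, ?_⟩
    by_contra! hlt
    -- Adding the two inequalities gives `μ * (x a + x b) ≤ A a b * (x a + x b)`.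
    nlinarith [mul_pos (sub_pos.2 hlt) (add_pos hxa hxb)]

/-- A nonzero vector of length five with entries of both signs, up to sign, has one or two
positive entries; the same holds for one of two nonzero orthogonal vectors. -/
theorem card_pos_le_two_or (x y : Fin 5 → ℝ) (hx : x ≠ 0) (hy : y ≠ 0) (hxy : ∑ i, x i * y i = 0) :
    ∃ z : Fin 5 → ℝ, (z = x ∨ z = -x ∨ z = y ∨ z = -y) ∧ (∃ i, 0 < z i) ∧
      (Finset.univ.filter fun i => 0 < z i).card ≤ 2 := by
  have mixed : ∀ z : Fin 5 → ℝ, (∃ i, 0 < z i) → (∃ i, z i < 0) →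
      ∃ w : Fin 5 → ℝ, (w = z ∨ w = -z) ∧ (∃ i, 0 < w i) ∧
      (Finset.univ.filter fun i => 0 < w i).card ≤ 2 := by
    intro z h1 h2
    by_cases hc : (Finset.univ.filter fun i => 0 < z i).card ≤ 2
    · exact ⟨z, .inl rfl, h1, hc⟩
    · refine ⟨-z, .inr rfl, by simpa using h2, ?_⟩
      have hd : Disjoint (Finset.univ.filter fun i => 0 < z i)
          (Finset.univ.filter fun i => 0 < (-z) i) :=
        Finset.disjoint_filter.2 fun i _ h h' => by simp at h'; linarith
      have := Finset.card_le_univ (Finset.disjUnion _ _ hd)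
      rw [Finset.card_disjUnion] at this
      simp only [Fintype.card_fin] at this
      omega
  have onesign : ∀ z : Fin 5 → ℝ, z ≠ 0 → ((∃ i, 0 < z i) ∧ ∃ i, z i < 0) ∨
      ∃ w : Fin 5 → ℝ, (w = z ∨ w = -z) ∧ (∀ i, 0 ≤ w i) ∧ ∃ i, 0 < w i := by
    intro z hz
    obtain ⟨k, hk⟩ := Function.ne_iff.1 hz
    by_cases h1 : ∃ i, 0 < z i
    · by_cases h2 : ∃ i, z i < 0
      · exact .inl ⟨h1, h2⟩
      · push Not at h2
        exact .inr ⟨z, .inl rfl, h2, h1⟩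
    · push Not at h1
      exact .inr ⟨-z, .inr rfl, fun i => by simpa using h1 i, k, by
        simpa using lt_of_le_of_ne (h1 k) hk⟩
  obtain ⟨h1, h2⟩ | ⟨v, hv, hv0, hvp⟩ := onesign x hx
  · obtain ⟨w, hw, h⟩ := mixed x h1 h2
    exact ⟨w, by tauto, h⟩
  obtain ⟨h1, h2⟩ | ⟨u, hu, hu0, hup⟩ := onesign y hy
  · obtain ⟨w, hw, h⟩ := mixed y h1 h2
    exact ⟨w, by tauto, h⟩
  -- Orthogonal nonnegative vectors have disjoint supports, so one support has at most two of the
  -- five indices.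
  have hvu : ∑ i, v i * u i = 0 := by
    rcases hv with rfl | rfl <;> rcases hu with rfl | rfl <;> simp [hxy]
  have hz := (Finset.sum_eq_zero_iff_of_nonneg fun i _ => mul_nonneg (hv0 i) (hu0 i)).1 hvu
  by_cases hc : (Finset.univ.filter fun i => 0 < v i).card ≤ 2
  · exact ⟨v, by tauto, hvp, hc⟩
  · refine ⟨u, by tauto, hup, ?_⟩
    have hd : Disjoint (Finset.univ.filter fun i => 0 < v i)
        (Finset.univ.filter fun i => 0 < u i) :=
      Finset.disjoint_filter.2 fun i _ h h' => (mul_pos h h').ne' (hz i (Finset.mem_univ i))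
    have := Finset.card_le_univ (Finset.disjUnion _ _ hd)
    rw [Finset.card_disjUnion] at this
    simp only [Fintype.card_fin] at this
    omega

/-- In a list realized by a trace zero symmetric nonnegative matrix of size five, the least entry
is at most the negative of the second largest, if the latter is positive. -/
theorem TraceZeroSymmNonnegRealizable.le_neg {σ : Fin 5 → ℝ}
    (h : TraceZeroSymmNonnegRealizable σ) {m μ : ℝ} (hm : ∀ k, m ≤ σ k) (hμ : 0 < μ)
    {a b : Fin 5} (hab : a ≠ b) (ha : μ ≤ σ a) (hb : μ ≤ σ b) : m ≤ -μ := by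
  obtain ⟨A, hA, hnn, htr, hspec⟩ := h
  have hdiag : ∀ i, A i i = 0 := fun i =>
    (Finset.sum_eq_zero_iff_of_nonneg fun i _ => hnn i i).1 htr i (Finset.mem_univ i)
  obtain ⟨U, hU, -, hAU⟩ := hspec.exists_orthogonal hA
  have heig : ∀ k i, ∑ j, A i j * U j k = σ k * U i k := fun k i => by
    have : A * U = U * Matrix.diagonal σ := by
      conv_lhs => rw [hAU]
      rw [Matrix.mul_assoc, hU, Matrix.mul_one]
    have := congrFun (congrFun this i) k
    rwa [Matrix.mul_apply, Matrix.mul_diagonal, mul_comm (U i k)] at this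
  have horth : ∀ k l, ∑ i, U i k * U i l = (1 : Matrix (Fin 5) (Fin 5) ℝ) k l := fun k l => by
    rw [← hU]; simp [Matrix.mul_apply]
  have hne : ∀ k, (fun i => U i k) ≠ 0 := fun k h0 => by
    have h1 := horth k k
    simp only [Matrix.one_apply_eq] at h1
    simp [fun i => show U i k = 0 from congrFun h0 i] at h1
  obtain ⟨z, hz, hzp, hzc⟩ := card_pos_le_two_or _ _ (hne a) (hne b)
    (by rw [horth, Matrix.one_apply_ne hab])
  obtain ⟨ν, hν, hzν⟩ : ∃ ν, μ ≤ ν ∧ ∀ i, ∑ j, A i j * z j = ν * z i := by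
    rcases hz with rfl | rfl | rfl | rfl
    · exact ⟨_, ha, heig a⟩
    · exact ⟨_, ha, fun i => by simp [heig a]⟩
    · exact ⟨_, hb, heig b⟩
    · exact ⟨_, hb, fun i => by simp [heig b]⟩
  obtain ⟨i, j, hij, hle⟩ :=
    exists_le_apply_of_card_pos_le_two hA hnn hdiag (hμ.trans_le hν) hzν hzp hzc
  have := hspec.apply_le_neg hA hdiag hm hij
  linarith

/-! ### Sufficiency: explicit realizing matrices -/

theorem isSpectrumOf_of_det_eq {n : ℕ} {σ : Fin n → ℝ} {A : Matrix (Fin n) (Fin n) ℝ}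
    (h : ∀ x : ℝ, (Matrix.scalar (Fin n) x - A).det = ∏ i, (x - σ i)) : IsSpectrumOf σ A := by
  have : A.charpoly = ∏ i, (Polynomial.X - Polynomial.C (σ i)) :=
    Polynomial.funext fun x => by
      rw [Matrix.eval_charpoly, h, Polynomial.eval_prod]; simp
  rw [IsSpectrumOf, this, Polynomial.roots_prod]
  · simp
  · simp [Finset.prod_ne_zero_iff, Polynomial.X_sub_C_ne_zero]

theorem TraceZeroSymmNonnegRealizable.of_comp_perm {n : ℕ} {σ : Fin n → ℝ}
    (e : Equiv.Perm (Fin n)) (h : TraceZeroSymmNonnegRealizable (σ ∘ e)) :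
    TraceZeroSymmNonnegRealizable σ := by
  obtain ⟨A, hA, hnn, htr, hs⟩ := h
  refine ⟨A, hA, hnn, htr, ?_⟩
  rw [IsSpectrumOf, hs, ← Multiset.map_map]
  congr 1
  exact Multiset.map_univ_val_equiv e

/-- A nonnegative matrix invariant under the reflection `0, 1 ↔ 4, 2 ↔ 3` realizes every list with
three positive entries that satisfies the necessary conditions. -/
theorem realizable_of_three_nonneg {r p q b c : ℝ} (hr : 0 ≤ r) (hp : 0 ≤ p) (hq : 0 ≤ q)
    (hb : 0 ≤ b) (hqc : q < c) (hsum : r + p + q = b + c)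
    (hcube : b ^ 3 + c ^ 3 ≤ r ^ 3 + p ^ 3 + q ^ 3) :
    TraceZeroSymmNonnegRealizable ![r, p, q, -b, -c] := by
  have hw : 0 < c - q := sub_pos.2 hqc
  -- The reflection splits the characteristic polynomial into a quadratic and a cubic, to be matched
  -- with `(x - q)(x + c)` and `(x - r)(x - p)(x + b)`. The constant terms fix `u` and `d = v - z`;
  -- the linear term of the cubic fixes `s = v + z`.
  set u := √(r * p * b / (2 * (c - q))) with hu
  set d := √(q * c) with hd
  have hu2 : 2 * u ^ 2 * (c - q) = r * p * b := by
    rw [hu, Real.sq_sqrt (by positivity)]; field_simp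
  have hd2 : d ^ 2 = q * c := by rw [hd, Real.sq_sqrt (mul_nonneg hq (hq.trans hqc.le))]
  -- Multiplied by `c - q`, this is one third of the cube inequality; it is what makes `z`
  -- nonnegative.
  have hδ : q * c ≤ b * (r + p) - r * p - 2 * u ^ 2 := by
    refine le_of_mul_le_mul_right ?_ hw
    obtain rfl : r = b + c - p - q := by linarith
    nlinarith
  set s := √(b * (r + p) - r * p - 2 * u ^ 2) with hs
  have hs2 : s ^ 2 = b * (r + p) - r * p - 2 * u ^ 2 := by
    rw [hs, Real.sq_sqrt (le_trans (mul_nonneg hq (hq.trans hqc.le)) hδ)]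
  have hds : d ≤ s := Real.sqrt_le_sqrt hδ
  have hd0 : 0 ≤ d := Real.sqrt_nonneg _
  have hu0 : 0 ≤ u := Real.sqrt_nonneg _
  obtain ⟨v, hv⟩ : ∃ v, v = (s + d) / 2 := ⟨_, rfl⟩
  obtain ⟨z, hz⟩ : ∃ z, z = (s - d) / 2 := ⟨_, rfl⟩
  obtain ⟨w, hwdef⟩ : ∃ w, w = c - q := ⟨_, rfl⟩
  have hv0 : 0 ≤ v := by linarith
  have hz0 : 0 ≤ z := by linarith
  have hw0 : 0 ≤ w := by linarith
  refine ⟨!![0, u, 0, 0, u; u, 0, v, z, 0; 0, v, 0, w, z; 0, z, w, 0, v; u, 0, z, v, 0],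
    ?_, ?_, ?_, isSpectrumOf_of_det_eq fun x => ?_⟩
  · ext i j; fin_cases i <;> fin_cases j <;> rfl
  · intro i j; fin_cases i <;> fin_cases j <;> simp [hu0, hv0, hz0, hw0]
  · simp [Matrix.trace, Fin.sum_univ_succ]
  · have hdet : ∀ x, (Matrix.scalar (Fin 5) x - !![0, u, 0, 0, u; u, 0, v, z, 0; 0, v, 0, w, z;
        0, z, w, 0, v; u, 0, z, v, 0]).det = (x ^ 2 + w * x - (v - z) ^ 2) *
          (x ^ 3 - w * x ^ 2 - (2 * u ^ 2 + (v + z) ^ 2) * x + 2 * u ^ 2 * w) := by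
      intro x
      simp [Matrix.det_succ_row_zero, Fin.sum_univ_succ, Matrix.submatrix, Fin.succAbove,
        Matrix.scalar]
      ring
    have h1 : (v - z) ^ 2 = q * c := by rw [← hd2, hv, hz]; ring
    have h2 : 2 * u ^ 2 + (v + z) ^ 2 = b * (r + p) - r * p := by
      rw [hv, hz, ← sub_eq_zero]; linear_combination hs2
    rw [hdet, h1, h2, hwdef, hu2]
    simp only [Fin.prod_univ_five]
    obtain rfl : r = b + c - p - q := by linarith
    simp
    ring

/-- A list with at most two positive entries is realized by gluing a block with eigenvalues
`a + b, -a, -b` to a block with eigenvalues `c, -c` along their Perron vectors. -/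
theorem realizable_of_three_nonpos {r p a b c : ℝ} (ha : 0 ≤ a) (hab : a ≤ b) (hbc : b ≤ c) (hcr : c ≤ r)
    (hpc : p ≤ c) (hpa : -a ≤ p) (hsum : r + p = a + b + c) :
    TraceZeroSymmNonnegRealizable ![r, p, -a, -b, -c] := by
  have hb : 0 ≤ b := ha.trans hab
  have hc : 0 ≤ c := hb.trans hbc
  -- The Perron vectors are proportional to `(g, l, l)` and `(1, 1)` when the blocks are nonzero.
  -- Coupling along them keeps the sum of `a + b` and `c` and lowers their product by `2(g² + 2l²) =
  -- 4(a + 2b)k`; `k` makes the new product `r * p`.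
  obtain ⟨k, hk0, hk⟩ : ∃ k, 0 ≤ k ∧ k * (4 * (a + 2 * b)) = (a + b) * c - r * p := by
    have hρ : 0 ≤ (a + b) * c - r * p := by
      -- Given the sum condition, the drop equals `(r - c)(c - p)`.
      have := mul_nonneg (sub_nonneg.2 hcr) (sub_nonneg.2 hpc)
      obtain rfl : r = a + b + c - p := by linarith
      linarith
    obtain hD | hD := (show 0 ≤ a + 2 * b by linarith).eq_or_lt
    · obtain rfl : b = 0 := by linarith
      obtain rfl : a = 0 := by linarith
      obtain rfl : p = 0 := by linarith
      exact ⟨0, le_rfl, by ring⟩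
    · exact ⟨((a + b) * c - r * p) / (4 * (a + 2 * b)), by positivity, div_mul_cancel₀ _ (by positivity)⟩
  obtain ⟨g, hg0, hg⟩ : ∃ g, 0 ≤ g ∧ g ^ 2 = 2 * b * k :=
    ⟨√(2 * b * k), Real.sqrt_nonneg _, Real.sq_sqrt (by positivity)⟩
  obtain ⟨l, hl0, hl⟩ : ∃ l, 0 ≤ l ∧ l ^ 2 = (a + b) * k :=
    ⟨√((a + b) * k), Real.sqrt_nonneg _, Real.sq_sqrt (by positivity)⟩
  obtain ⟨h, hh0, hh⟩ : ∃ h, 0 ≤ h ∧ h ^ 2 = b * (a + b) / 2 :=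
    ⟨√(b * (a + b) / 2), Real.sqrt_nonneg _, Real.sq_sqrt (by positivity)⟩
  have hghl : g * h * l = b * (a + b) * k := by
    refine (pow_left_inj₀ (by positivity) (by positivity) two_ne_zero).1 ?_
    rw [mul_pow, mul_pow, hg, hh, hl]; ring
  refine ⟨!![0, h, h, g, g; h, 0, a, l, l; h, a, 0, l, l; g, l, l, 0, c; g, l, l, c, 0],
    ?_, ?_, ?_, isSpectrumOf_of_det_eq fun x => ?_⟩
  · ext i j; fin_cases i <;> fin_cases j <;> rfl
  · intro i j; fin_cases i <;> fin_cases j <;> simp [hg0, hh0, hl0, ha, hc]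
  · simp [Matrix.trace, Fin.sum_univ_succ]
  · have hdet : ∀ x, (Matrix.scalar (Fin 5) x - !![0, h, h, g, g; h, 0, a, l, l; h, a, 0, l, l;
        g, l, l, 0, c; g, l, l, c, 0]).det = (x + a) * (x + c) * (x * ((x - a) * (x - c) - 4 * l ^ 2)
          - 2 * h ^ 2 * (x - c) - 2 * g ^ 2 * (x - a) - 8 * (g * h * l)) := by
      intro x
      simp [Matrix.det_succ_row_zero, Fin.sum_univ_succ, Matrix.submatrix, Fin.succAbove,
        Matrix.scalar]
      ring
    rw [hdet, hl, hh, hg, hghl]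
    simp only [Fin.prod_univ_five]
    obtain rfl : r = a + b + c - p := by linarith
    simp
    linear_combination (-(x + a) * (x + b) * (x + c)) * hk

/-- Sufficient conditions for a decreasing list of five reals to be realizable. -/
theorem TraceZeroSymmNonnegRealizable.of_antitone {τ : Fin 5 → ℝ} (hτ : Antitone τ)
    (hsum : ∑ i, τ i = 0) (h04 : 0 ≤ τ 0 + τ 4) (h14 : τ 1 + τ 4 ≤ 0)
    (hcube : 0 ≤ ∑ i, τ i ^ 3) : TraceZeroSymmNonnegRealizable τ := by
  have h01 : τ 1 ≤ τ 0 := hτ (by decide)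
  have h12 : τ 2 ≤ τ 1 := hτ (by decide)
  have h23 : τ 3 ≤ τ 2 := hτ (by decide)
  have h34 : τ 4 ≤ τ 3 := hτ (by decide)
  rw [Fin.sum_univ_five] at hsum hcube
  have hτeq : τ = ![τ 0, τ 1, τ 2, -(-τ 3), -(-τ 4)] := by
    ext i; fin_cases i <;> simp
  have hτeq' : τ = ![τ 0, τ 1, -(-τ 2), -(-τ 3), -(-τ 4)] := by
    ext i; fin_cases i <;> simp
  obtain h2 | h2 := le_total (τ 2) 0
  · rw [hτeq']
    apply realizable_of_three_nonpos <;> linarith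
  -- Equality forces the whole list to vanish; otherwise `q < c` holds strictly.
  obtain h24 | h24 := (show 0 ≤ -(τ 2 + τ 4) by linarith).eq_or_lt
  · rw [hτeq']
    apply realizable_of_three_nonpos <;> linarith
  · rw [hτeq]
    apply realizable_of_three_nonneg <;> linarith

/-- Order-free sufficient conditions for a list of five reals to be realizable. -/
theorem TraceZeroSymmNonnegRealizable.of_sum_cube_nonneg {f : Fin 5 → ℝ}
    (hsum : ∑ i, f i = 0) (hcube : 0 ≤ ∑ i, f i ^ 3) (h0 : ∀ i, 0 ≤ f 0 + f i)
    {k : Fin 5} (hk : ∀ j, j ≠ 0 → f j + f k ≤ 0) : TraceZeroSymmNonnegRealizable f := by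
  obtain ⟨e, he⟩ : ∃ e : Equiv.Perm (Fin 5), Antitone (f ∘ e) :=
    ⟨Tuple.sort (-f), fun i j hij => neg_le_neg_iff.1 (Tuple.monotone_sort (-f) hij)⟩
  have hfirst : ∀ i, f i ≤ f (e 0) := fun i => by
    simpa using he (Fin.zero_le (e.symm i))
  have hlast : ∀ i, f (e 4) ≤ f i := fun i => by
    simpa using he (Fin.le_last (e.symm i))
  refine .of_comp_perm e (.of_antitone he ?_ ?_ ?_ ?_)
  · simpa [← hsum] using Equiv.sum_comp e f
  · exact (h0 (e 4)).trans (add_le_add_left (hfirst 0) _)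
  · by_cases h : e 1 = 0
    · have h' : e 0 ≠ 0 := fun h' => absurd (e.injective (h.trans h'.symm)) (by decide)
      have := hk _ h'
      have h01 : f (e 1) ≤ f (e 0) := he (by decide)
      exact (add_le_add h01 (hlast k)).trans this
    · exact (add_le_add le_rfl (hlast k)).trans (hk _ h)
  · simpa using hcube.trans_eq (Equiv.sum_comp e fun i => f i ^ 3).symm

/-! ### The perturbed list -/

theorem mainTheorem6 (σ : Fin 5 → ℝ) (hdesc : Antitone σ) (hlast : -σ 0 ≤ σ 4)
    (hσ : TraceZeroSymmNonnegRealizable σ) (s : ℝ) (hs : 0 < s) (i : Fin 5) (hi : i ≠ 0) :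
    TraceZeroSymmNonnegRealizable (guoMinus σ i s) := by
  have h0 : ∀ j, σ j ≤ σ 0 := fun j => hdesc (Fin.zero_le j)
  have h4 : ∀ j, σ 4 ≤ σ j := fun j => hdesc (Fin.le_last j)
  obtain ⟨hsum, hcube⟩ : ∑ j, σ j = 0 ∧ 0 ≤ ∑ j, σ j ^ 3 := by
    obtain ⟨A, hA, hnn, htr, hspec⟩ := hσ
    refine ⟨(hspec.sum_eq_trace hA).trans htr, ?_⟩
    rw [hspec.sum_cube_eq_trace hA, pow_three]
    simp only [Matrix.trace, Matrix.diag, Matrix.mul_apply]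
    exact Finset.sum_nonneg fun _ _ => Finset.sum_nonneg fun _ _ => mul_nonneg (hnn _ _) <|
      Finset.sum_nonneg fun _ _ => mul_nonneg (hnn _ _) (hnn _ _)
  have h14 : σ 1 + σ 4 ≤ 0 := by
    obtain h1 | h1 := le_or_gt (σ 1) 0
    · linarith [h4 1]
    · linarith [hσ.le_neg h4 h1 (a := 0) (b := 1) (by decide) (h0 1) le_rfl]
  have hf0 : guoMinus σ i s 0 = σ 0 + s := by simp [guoMinus, hi.symm]
  have hfi : guoMinus σ i s i = σ i - s := by simp [guoMinus]
  have hfj : ∀ j, j ≠ 0 → j ≠ i → guoMinus σ i s j = σ j := fun j hj hji => by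
    simp [guoMinus, hj, hji]
  have hfle : ∀ j, j ≠ 0 → guoMinus σ i s j ≤ σ j := fun j hj => by
    by_cases hji : j = i
    · subst hji; rw [hfi]; linarith
    · rw [hfj j hj hji]
  have hpow : ∀ φ : ℝ → ℝ, ∑ j, φ (guoMinus σ i s j)
      = ∑ j, φ (σ j) + (φ (σ 0 + s) - φ (σ 0)) + (φ (σ i - s) - φ (σ i)) := fun φ => by
    have h : ∀ τ : Fin 5 → ℝ, ∑ j, φ (τ j) = φ (τ 0) + (φ (τ i) +
        ∑ j ∈ (Finset.univ.erase 0).erase i, φ (τ j)) := fun τ => by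
      rw [Finset.add_sum_erase _ (fun j => φ (τ j)) (by simp [hi]),
        Finset.add_sum_erase _ (fun j => φ (τ j)) (by simp)]
    rw [h, h σ, hf0, hfi, Finset.sum_congr rfl fun j hj => by
      rw [hfj j (Finset.ne_of_mem_erase (Finset.mem_of_mem_erase hj)) (Finset.ne_of_mem_erase hj)]]
    ring
  -- The entry at `i` may become the least, but index `4` still witnesses the bound, since its entry
  -- has not increased.
  refine .of_sum_cube_nonneg (k := 4) ?_ ?_ ?_ ?_
  · have := hpow id
    simp only [id] at this
    rw [this, hsum]; ring
  -- One third of the increase of the sum of cubes.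
  · have hinc : 0 ≤ s * (σ 0 + σ i) * (σ 0 - σ i + s) :=
      mul_nonneg (mul_nonneg hs.le (by linarith [h4 i])) (by linarith [h0 i])
    rw [hpow fun x => x ^ 3]
    linarith
  · intro j
    rw [hf0]
    by_cases hj : j = 0
    · subst hj; rw [hf0]; linarith [h0 4]
    by_cases hji : j = i
    · subst hji; rw [hfi]; linarith [h4 j]
    · rw [hfj j hj hji]; linarith [h4 j]
  · intro j hj
    have h1j : σ j ≤ σ 1 := hdesc (Fin.one_le_of_ne_zero hj)
    linarith [hfle j hj, hfle 4 (by decide)]
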